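/- A binary code of length $n$ is a linear subspace $C\subseteq\mathbb{F}_2^n$; it is *self-dual* if it equals its dual $C^\perp$ under the standard inner product, and *doubly even* if every codeword has Hamming weight divisible by $4$. A doubly even self-dual code of length $n$ is *extremal* if its minimum weight (the least weight of a nonzero codeword) equals $4\lfloor n/24\rfloor+4$. A $t$-$(v,k,\lambda)$ design is a set $X$ of $v$ points together with a set of $k$-element subsets of $X$, called blocks (no repeated blocks), such that every $t$-element subset of $X$ is contained in exactly $\lambda$ blocks; it is *self-orthogonal* if for any two distinct blocks $B,B'$ the number $|B\cap B'|$ has the same parity as $k$. **Theorem.** Let $(24m,k,\lambda)$ be one of $(72,24,1406405)$, $(72,32,238957796)$, $(96,36,28080500448)$, $(96,44,1167789832440)$, $(120,56,5156299310025435)$, $(144,68,21788133027489299328)$. Then a self-orthogonal $5$-$(24m,k,\lambda)$ design exists if and only if an extremal doubly even self-dual code of length $24m$ exists. -/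

import Mathlib

/-- A (simple) `t`-`(v,k,lam)` design: a finite point set `X` with `v` points and a set `B` of
`k`-element subsets of `X` (the blocks), such that every `t`-element subset of `X` is contained in
exactly `lam` blocks. -/
structure IsDesign {X : Type*} [Fintype X] [DecidableEq X] (t v k lam : ℕ)
    (B : Finset (Finset X)) : Prop where
  card_points : Fintype.card X = v
  card_block : ∀ b ∈ B, b.card = k
  balanced : ∀ T : Finset X, T.card = t → (B.filter (fun b => T ⊆ b)).card = lam

/-- A design is self-orthogonal if any two distinct blocks meet in a number of points which has
the same parity as the block size `k`. -/
structure IsSelfOrthogonalDesign {X : Type*} [Fintype X] [DecidableEq X] (t v k lam : ℕ)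
    (B : Finset (Finset X)) : Prop extends IsDesign t v k lam B where
  inter_parity : ∀ b₁ ∈ B, ∀ b₂ ∈ B, b₁ ≠ b₂ → (b₁ ∩ b₂).card ≡ k [MOD 2]

/-- A binary (linear) code of length `n` is a subspace of `𝔽₂ⁿ`. -/
abbrev BinaryCode (n : ℕ) := Submodule (ZMod 2) (Fin n → ZMod 2)

namespace BinaryCode

/-- The dual code under the standard inner product. -/
def dual {n : ℕ} (C : BinaryCode n) : BinaryCode n where
  carrier := {x | ∀ c ∈ C, x ⬝ᵥ c = 0}
  zero_mem' := fun c _ => zero_dotProduct c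
  add_mem' := fun {x y} hx hy c hc => by rw [add_dotProduct, hx c hc, hy c hc, add_zero]
  smul_mem' := fun a x hx c hc => by rw [smul_dotProduct, hx c hc, smul_zero]

/-- A code is self-dual if it equals its dual. -/
def IsSelfDual {n : ℕ} (C : BinaryCode n) : Prop := C = dual C

/-- A code is doubly even if every codeword has (Hamming) weight divisible by `4`. -/
def IsDoublyEven {n : ℕ} (C : BinaryCode n) : Prop := ∀ c ∈ C, 4 ∣ hammingNorm c

/-- `C` has minimum weight `d`: `d` is the smallest weight of a nonzero codeword. -/
def HasMinWeight {n : ℕ} (C : BinaryCode n) (d : ℕ) : Prop :=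
  IsLeast {w : ℕ | ∃ c ∈ C, c ≠ 0 ∧ hammingNorm c = w} d

/-- An extremal doubly even self-dual code of length `n`: a doubly even self-dual code with minimum
weight `4⌊n/24⌋ + 4`. -/
structure IsExtremalDoublyEvenSelfDual {n : ℕ} (C : BinaryCode n) : Prop where
  doublyEven : IsDoublyEven C
  selfDual : IsSelfDual C
  minWeight : HasMinWeight C (4 * (n / 24) + 4)

end BinaryCode

/-! A code is replaced by the family of supports of its words. Poisson summation over a self-dual
family (`SelfDualFamily.card_supersets`) gives the binomial moments of its sizes.

From design to code: as 4 divides k, the blocks are doubly even and pairwise orthogonal, and as 8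
divides 24m, a Gauss sum puts them into a doubly even self-dual family W (`exists_selfDualFamily`).
A member of size 4 or 8 would meet all blocks in 0, 2, 4, 6 or 8 points; the quintic with these
roots, summed over the blocks, contradicts the design counts (`IsDesign.not_forall_even`). Sizes 12,
..., 4m fall to a linear programming argument (`SelfDualFamily.four_mul_lt_card`): take the moment
identity for the polynomial of degree 4m - 2 that vanishes at 4m + 4, ..., 20m - 4 except k. The
terms of the empty set, the full set and the blocks cancel, no other term is negative, and a small
member would add a positive one.

From code to design, as in the Assmus-Mattson theorem (`SelfDualFamily.card_mul_add`): the moments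
up to order 4m - 2 of the members through a 5-set are known, and a polynomial of that degree
isolates size k. The same count at k = 4m + 4 shows that the minimum weight is attained. -/

open Finset
open scoped symmDiff

/-! ### Self-dual families: characters and moments -/

section SelfDualFamily

variable {α : Type*} [DecidableEq α]

/-- A family of subsets of `α` is self-dual if its members are exactly the sets which meet every
member in an even number of points. These are the families of supports of self-dual codes. -/
def SelfDualFamily (W : Finset (Finset α)) : Prop :=
  ∀ y, y ∈ W ↔ ∀ c ∈ W, Even (#(y ∩ c))

theorem neg_one_pow_card_symmDiff_inter (a b c : Finset α) :
    (-1 : ℤ) ^ #((a ∆ b) ∩ c) = (-1) ^ #(a ∩ c) * (-1) ^ #(b ∩ c) := by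
  have h (s : Finset α) : (-1 : ℤ) ^ #(s ∩ c) = ∏ i ∈ c, if i ∈ s then -1 else 1 := by
    rw [← Finset.prod_filter, Finset.prod_const, inter_comm]
    congr 2
  rw [h, h, h, ← Finset.prod_mul_distrib]
  refine Finset.prod_congr rfl fun i _ => ?_
  by_cases ha : i ∈ a <;> by_cases hb : i ∈ b <;> simp [mem_symmDiff, ha, hb]

theorem even_card_symmDiff_inter (a b c : Finset α) :
    Even #((a ∆ b) ∩ c) ↔ (Even #(a ∩ c) ↔ Even #(b ∩ c)) := by
  have h := neg_one_pow_card_symmDiff_inter a b c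
  rcases Nat.even_or_odd #((a ∆ b) ∩ c) with h1 | h1 <;>
  rcases Nat.even_or_odd #(a ∩ c) with h2 | h2 <;>
  rcases Nat.even_or_odd #(b ∩ c) with h3 | h3 <;>
  simp_all [h1.neg_one_pow, h2.neg_one_pow, h3.neg_one_pow, ← Nat.not_even_iff_odd]

theorem card_symmDiff_add (a b : Finset α) : #(a ∆ b) + 2 * #(a ∩ b) = #a + #b := by
  have h1 : #(a ∆ b) = #(a \ b) + #(b \ a) := by
    rw [symmDiff_def, sup_eq_union, card_union_of_disjoint]
    exact disjoint_sdiff_sdiff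
  have h2 := card_sdiff_add_card_inter a b
  have h3 := card_sdiff_add_card_inter b a
  rw [inter_comm b a] at h3
  omega

/-- Orthogonality of characters for a family of sets closed under symmetric difference. -/
theorem sum_neg_one_pow_card_inter {W : Finset (Finset α)}
    (hW : ∀ a ∈ W, ∀ b ∈ W, a ∆ b ∈ W) (y : Finset α) :
    ∑ c ∈ W, (-1 : ℤ) ^ #(y ∩ c) = if ∀ c ∈ W, Even #(y ∩ c) then (#W : ℤ) else 0 := by
  split_ifs with hy
  · rw [Finset.sum_congr rfl fun c hc => (hy c hc).neg_one_pow]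
    simp
  · push Not at hy
    obtain ⟨d, hd, hdy⟩ := hy
    -- Translation by d permutes the family but flips every sign, so the sum is its own negative.
    have key : ∑ c ∈ W, (-1 : ℤ) ^ #(y ∩ c) = ∑ c ∈ W, (-1 : ℤ) ^ #(y ∩ (c ∆ d)) := by
      refine (Finset.sum_nbij' (· ∆ d) (· ∆ d) ?_ ?_ ?_ ?_ ?_).symm
      · exact fun c hc => hW c hc d hd
      · exact fun c hc => hW c hc d hd
      · exact fun c _ => symmDiff_symmDiff_cancel_right d c
      · exact fun c _ => symmDiff_symmDiff_cancel_right d c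
      · exact fun c _ => rfl
    have h2 : ∑ c ∈ W, (-1 : ℤ) ^ #(y ∩ (c ∆ d)) = - ∑ c ∈ W, (-1 : ℤ) ^ #(y ∩ c) := by
      rw [← Finset.sum_neg_distrib]
      refine Finset.sum_congr rfl fun c _ => ?_
      rw [inter_comm, neg_one_pow_card_symmDiff_inter, inter_comm d,
        (Nat.not_even_iff_odd.1 hdy).neg_one_pow, inter_comm c]
      ring
    rw [h2] at key
    omega

/-- The number of sets of size `#T + i` between `T` and `c`. -/
theorem card_between [Fintype α] {T c : Finset α} (h : T ⊆ c) (i : ℕ) :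
    #{S : Finset α | T ⊆ S ∧ S ⊆ c ∧ #S = #T + i} = (#c - #T).choose i := by
  rw [← card_sdiff_of_subset h, ← card_powersetCard]
  refine card_nbij' (· \ T) (· ∪ T) ?_ ?_ ?_ ?_
  · intro S hS
    simp only [coe_filter, mem_univ, true_and, Set.mem_ofPred_eq] at hS
    simp only [mem_coe, mem_powersetCard]
    refine ⟨sdiff_subset_sdiff hS.2.1 le_rfl, ?_⟩
    rw [card_sdiff_of_subset hS.1]; omega
  · intro S hS
    simp only [mem_coe, mem_powersetCard] at hS
    simp only [coe_filter, mem_univ, true_and, Set.mem_ofPred_eq]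
    refine ⟨subset_union_right, union_subset (hS.1.trans sdiff_subset) h, ?_⟩
    rw [card_union_of_disjoint (disjoint_of_subset_left hS.1 sdiff_disjoint)]; omega
  · intro S hS
    simp only [coe_filter, mem_univ, true_and, Set.mem_ofPred_eq] at hS
    exact sdiff_union_of_subset hS.1
  · intro S hS
    simp only [mem_coe, mem_powersetCard] at hS
    exact union_sdiff_cancel_right (disjoint_of_subset_left hS.1 sdiff_disjoint)

namespace SelfDualFamily

variable {W : Finset (Finset α)}

theorem even_card (hW : SelfDualFamily W) {c : Finset α} (hc : c ∈ W) : Even #c := by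
  simpa using (hW c).1 hc c hc

theorem empty_mem (hW : SelfDualFamily W) : ∅ ∈ W := (hW _).2 fun c _ => by simp

theorem symmDiff_mem (hW : SelfDualFamily W) {a b : Finset α} (ha : a ∈ W) (hb : b ∈ W) :
    a ∆ b ∈ W :=
  (hW _).2 fun c hc => by
    rw [even_card_symmDiff_inter]
    exact iff_of_true ((hW a).1 ha c hc) ((hW b).1 hb c hc)

theorem sum_character (hW : SelfDualFamily W) (y : Finset α) :
    ∑ c ∈ W, (-1 : ℤ) ^ #(y ∩ c) = if y ∈ W then (#W : ℤ) else 0 := by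
  rw [sum_neg_one_pow_card_inter fun a ha b hb => hW.symmDiff_mem ha hb]
  exact if_congr (hW y).symm rfl rfl

/-- Expand the indicator of S ⊆ c, times 2 ^ #S, as a product over S of 1 ± 1, that is, as a signed
sum of characters indexed by t ⊆ S. Summing over W kills every t outside W. This is the MacWilliams
identity in local form. -/
theorem card_supersets (hW : SelfDualFamily W) (S : Finset α) :
    #{c ∈ W | S ⊆ c} * 2 ^ #S = #W * #{x ∈ W | x ⊆ S} := by
  have h1 (c : Finset α) :
      (if S ⊆ c then (2 : ℤ) ^ #S else 0) = ∑ t ∈ S.powerset, (-1 : ℤ) ^ #t * (-1) ^ #(t ∩ c) := by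
    have h := Finset.prod_add (fun i => if i ∈ c then (1 : ℤ) else -1) (fun _ => (1 : ℤ)) S
    have h2 : ∏ i ∈ S, ((if i ∈ c then (1 : ℤ) else -1) + 1) =
        if S ⊆ c then (2 : ℤ) ^ #S else 0 := by
      split_ifs with hS
      · rw [Finset.prod_congr rfl fun i hi => by rw [if_pos (hS hi)]]
        simp
      · obtain ⟨i, hi, hic⟩ := Finset.not_subset.1 hS
        exact Finset.prod_eq_zero hi (by simp [hic])
    rw [← h2, h]
    refine Finset.sum_congr rfl fun t _ => ?_
    rw [Finset.prod_const_one, mul_one]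
    have h3 : (-1 : ℤ) ^ #(t ∩ c) = ∏ i ∈ t, if i ∈ c then -1 else 1 := by
      rw [← Finset.prod_filter, Finset.prod_const, filter_mem_eq_inter]
    rw [h3, ← Finset.prod_const, ← Finset.prod_mul_distrib]
    refine Finset.prod_congr rfl fun i _ => ?_
    split_ifs <;> simp
  have h2 : ((#{c ∈ W | S ⊆ c} * 2 ^ #S : ℕ) : ℤ) = ((#W * #{x ∈ W | x ⊆ S} : ℕ) : ℤ) := by
    calc ((#{c ∈ W | S ⊆ c} * 2 ^ #S : ℕ) : ℤ)
        = ∑ c ∈ W, if S ⊆ c then (2 : ℤ) ^ #S else 0 := by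
          rw [← Finset.sum_filter]; simp
      _ = ∑ t ∈ S.powerset, (-1 : ℤ) ^ #t * ∑ c ∈ W, (-1) ^ #(t ∩ c) := by
          simp_rw [h1, Finset.mul_sum]
          exact Finset.sum_comm
      _ = ∑ t ∈ S.powerset, if t ∈ W then (#W : ℤ) else 0 := by
          refine Finset.sum_congr rfl fun t _ => ?_
          rw [hW.sum_character]
          split_ifs with ht
          · rw [(hW.even_card ht).neg_one_pow, one_mul]
          · rw [mul_zero]
      _ = _ := by
          rw [← Finset.sum_filter, Finset.sum_const, nsmul_eq_mul, mul_comm]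
          push_cast
          congr 3
          ext x
          simp [and_comm]
  exact_mod_cast h2

variable [Fintype α]

theorem univ_mem (hW : SelfDualFamily W) : univ ∈ W :=
  (hW _).2 fun c hc => by simpa using hW.even_card hc

theorem compl_mem (hW : SelfDualFamily W) {a : Finset α} (ha : a ∈ W) : aᶜ ∈ W := by
  have := hW.symmDiff_mem ha hW.univ_mem
  rwa [← top_eq_univ, symmDiff_top] at this

theorem card_sq (hW : SelfDualFamily W) : #W * #W = 2 ^ Fintype.card α := by
  have h := hW.card_supersets univ
  have h1 : ({c ∈ W | univ ⊆ c} : Finset (Finset α)) = {univ} := by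
    ext c
    simp only [mem_filter, mem_singleton, univ_subset_iff]
    exact ⟨fun h => h.2, fun h => ⟨h ▸ hW.univ_mem, h⟩⟩
  rw [h1] at h
  simpa using h.symm

theorem card_eq (hW : SelfDualFamily W) {r : ℕ} (hr : Fintype.card α = 2 * r) : #W = 2 ^ r := by
  have h := hW.card_sq
  rw [hr, two_mul, pow_add] at h
  exact Nat.mul_self_inj.1 h

theorem sum_choose_supersets (hW : SelfDualFamily W) (T : Finset α) (i : ℕ) :
    (∑ c ∈ W with T ⊆ c, (#c - #T).choose i) * 2 ^ (#T + i) =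
      #W * ∑ S : Finset α with T ⊆ S ∧ #S = #T + i, #{x ∈ W | x ⊆ S} := by
  have h1 : ∑ c ∈ W with T ⊆ c, (#c - #T).choose i =
      ∑ S : Finset α with T ⊆ S ∧ #S = #T + i, #{c ∈ W | S ⊆ c} := by
    rw [Finset.sum_congr rfl fun c hc => (card_between (mem_filter.1 hc).2 i).symm]
    simp_rw [Finset.card_eq_sum_ones]
    refine Finset.sum_comm' fun c S => ?_
    simp only [mem_filter, mem_univ, true_and]
    constructor
    · rintro ⟨⟨h1, h2⟩, h3, h4, h5⟩
      exact ⟨⟨h1, h4⟩, h3, h5⟩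
    · rintro ⟨⟨h1, h2⟩, h3, h4⟩
      exact ⟨⟨h1, h3.trans h2⟩, h3, h2, h4⟩
  rw [h1, Finset.sum_mul, Finset.mul_sum]
  refine Finset.sum_congr rfl fun S hS => ?_
  rw [← (mem_filter.1 hS).2.2, hW.card_supersets]

/-- The binomial moments of the members through `T`, below the minimum size `d`. -/
theorem sum_choose_supersets_of_lt (hW : SelfDualFamily W) {d : ℕ}
    (hd : ∀ c ∈ W, c.Nonempty → d ≤ #c) (T : Finset α)
    {i : ℕ} (hi : #T + i < d) :
    (∑ c ∈ W with T ⊆ c, (#c - #T).choose i) * 2 ^ (#T + i) =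
      #W * (Fintype.card α - #T).choose i := by
  have h (S : Finset α) (hS : #S = #T + i) : #{x ∈ W | x ⊆ S} = 1 := by
    rw [card_eq_one]
    refine ⟨∅, ?_⟩
    ext x
    simp only [mem_filter, mem_singleton]
    constructor
    · rintro ⟨h1, h2⟩
      by_contra h3
      have := hd x h1 (nonempty_iff_ne_empty.2 h3)
      have := card_le_card h2
      omega
    · rintro rfl
      exact ⟨hW.empty_mem, empty_subset _⟩
  rw [hW.sum_choose_supersets, ← card_univ, ← card_between (subset_univ T),
    Finset.sum_congr rfl fun S hS => h S (mem_filter.1 hS).2.2, ← card_eq_sum_ones]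
  simp

/-- The binomial moments of the sizes of the members (the Pless power moments). -/
theorem sum_choose_card (hW : SelfDualFamily W) {i : ℕ} (hi : i ≤ Fintype.card α) :
    (∑ c ∈ W, (#c).choose i) * 2 ^ i =
      #W * ∑ x ∈ W, (Fintype.card α - #x).choose (Fintype.card α - i) := by
  have h := hW.sum_choose_supersets ∅ i
  simp only [empty_subset, filter_true, card_empty, Nat.sub_zero, zero_add, true_and] at h
  rw [h]
  congr 1
  rw [Finset.sum_congr rfl fun S _ => card_eq_sum_ones _]
  rw [Finset.sum_comm' (s' := fun x => univ.filter fun S => x ⊆ S ∧ #S = i) (t' := W)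
    (by intro S x; simp; tauto)]
  refine Finset.sum_congr rfl fun x hx => ?_
  rw [← card_eq_sum_ones]
  -- The lower index n - i makes the binomial vanish when #x > i; the equivalent index i - #x would
  -- truncate to 0 there.
  by_cases hxi : #x ≤ i
  · have hb := card_between (subset_univ x) (i - #x)
    rw [card_univ] at hb
    rw [Nat.choose_symm_of_eq_add (a := Fintype.card α - i) (b := i - #x) (by omega), ← hb]
    congr 1
    ext S
    simp [Nat.add_sub_cancel' hxi]
  · have := card_le_univ x
    rw [Nat.choose_eq_zero_of_lt (by omega), card_eq_zero]
    ext S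
    simp only [mem_filter, mem_univ, true_and, notMem_empty, iff_false, not_and]
    intro h1 h2
    have := card_le_card h1
    omega

end SelfDualFamily

end SelfDualFamily

/-! ### Extension to a doubly even self-dual family -/

section MaximalDoublyEven

variable {α : Type*} [Fintype α] [DecidableEq α]

theorem sum_neg_one_pow_card_inter_mul_pow (z : ℂ) (c : Finset α) :
    ∑ v : Finset α, (-1 : ℂ) ^ #(v ∩ c) * z ^ #v =
      (1 - z) ^ #c * (1 + z) ^ (Fintype.card α - #c) := by
  have h := Finset.prod_add (fun i => if i ∈ c then -z else z) (fun _ => (1 : ℂ)) univ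
  rw [powerset_univ] at h
  have h1 : ∏ i : α, ((if i ∈ c then -z else z) + 1) =
      (1 - z) ^ #c * (1 + z) ^ (Fintype.card α - #c) := by
    rw [← card_compl, ← Finset.prod_const, ← Finset.prod_const, ← Finset.prod_mul_prod_compl c]
    congr 1
    · refine Finset.prod_congr rfl fun i hi => ?_
      rw [if_pos hi]; ring
    · refine Finset.prod_congr rfl fun i hi => ?_
      rw [if_neg (mem_compl.1 hi)]; ring
  rw [← h1, h]
  refine Finset.sum_congr rfl fun v _ => ?_
  have h3 : (-1 : ℂ) ^ #(v ∩ c) = ∏ i ∈ v, if i ∈ c then -1 else 1 := by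
    rw [← Finset.prod_filter, Finset.prod_const, filter_mem_eq_inter]
  rw [h3, ← Finset.prod_const, ← Finset.prod_mul_distrib, Finset.prod_const_one, mul_one]
  refine Finset.prod_congr rfl fun i _ => ?_
  split_ifs <;> simp

/-- A maximal doubly even self-orthogonal family on `8r` points is self-dual. -/
theorem selfDualFamily_of_maximal {r : ℕ} (hr : Fintype.card α = 8 * r)
    {W : Finset (Finset α)}
    (hW : ∀ v, v ∈ W ↔ 4 ∣ #v ∧ ∀ c ∈ W, Even #(v ∩ c)) : SelfDualFamily W := by
  have hsymm : ∀ a ∈ W, ∀ b ∈ W, a ∆ b ∈ W := by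
    intro a ha b hb
    rw [hW]
    constructor
    · have h1 := card_symmDiff_add a b
      have h2 := ((hW a).1 ha).1
      have h3 := ((hW b).1 hb).1
      obtain ⟨t, ht⟩ := ((hW a).1 ha).2 b hb
      omega
    · intro c hc
      rw [even_card_symmDiff_inter]
      exact iff_of_true (((hW a).1 ha).2 c hc) (((hW b).1 hb).2 c hc)
  have huniv : univ ∈ W := by
    rw [hW, card_univ, hr]
    refine ⟨⟨2 * r, by ring⟩, fun c hc => ?_⟩
    rw [univ_inter, even_iff_two_dvd]
    exact (by norm_num : 2 ∣ 4).trans ((hW c).1 hc).1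
  set D : Finset (Finset α) := {v | ∀ c ∈ W, Even #(v ∩ c)} with hD
  have hWD : W ⊆ D := fun v hv => by simpa [hD] using ((hW v).1 hv).2
  -- Poisson summation: each c in W contributes (1 - i) ^ #c (1 + i) ^ (8r - #c), which is (-4) ^
  -- (2r) because 4 divides #c.
  have gauss : ∑ v ∈ D, Complex.I ^ #v = 16 ^ r := by
    have h1 : ∑ c ∈ W, ∑ v : Finset α, (-1 : ℂ) ^ #(v ∩ c) * Complex.I ^ #v = #W * 16 ^ r := by
      rw [Finset.sum_congr rfl fun c hc => sum_neg_one_pow_card_inter_mul_pow Complex.I c,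
        ← nsmul_eq_mul, ← Finset.sum_const]
      refine Finset.sum_congr rfl fun c hc => ?_
      obtain ⟨a, ha⟩ := ((hW c).1 hc).1
      have hcn := card_le_univ c
      have hb : Fintype.card α - #c = 4 * (2 * r - a) := by omega
      have e1 : (1 - Complex.I) ^ 4 = -4 := by
        ring_nf; simp [Complex.I_pow_three, Complex.I_pow_four]; ring
      have e2 : (1 + Complex.I) ^ 4 = -4 := by
        ring_nf; simp [Complex.I_pow_three, Complex.I_pow_four]; ring
      rw [hb, ha, pow_mul, pow_mul, e1, e2, ← pow_add,
        show a + (2 * r - a) = 2 * r by omega, pow_mul]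
      norm_num
    have h2 : ∑ c ∈ W, ∑ v : Finset α, (-1 : ℂ) ^ #(v ∩ c) * Complex.I ^ #v =
        #W * ∑ v ∈ D, Complex.I ^ #v := by
      rw [Finset.sum_comm, hD, Finset.sum_filter, Finset.mul_sum]
      refine Finset.sum_congr rfl fun v _ => ?_
      rw [← Finset.sum_mul]
      have := congrArg (Int.cast (R := ℂ)) (sum_neg_one_pow_card_inter hsymm v)
      push_cast at this
      rw [this]
      split_ifs <;> simp
    have h3 : (#W : ℂ) ≠ 0 := by
      exact_mod_cast (card_pos.2 ⟨_, huniv⟩).ne'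
    exact mul_left_cancel₀ h3 (h2.symm.trans h1)
  have hval : ∀ v ∈ D, Complex.I ^ #v = if v ∈ W then 1 else -1 := by
    intro v hv
    have hv' : ∀ c ∈ W, Even #(v ∩ c) := by simpa [hD] using hv
    obtain ⟨t, ht⟩ := hv' univ huniv
    rw [inter_univ, ← two_mul] at ht
    rw [ht, pow_mul, Complex.I_sq]
    split_ifs with h
    · have := ((hW v).1 h).1
      exact Even.neg_one_pow (by rw [Nat.even_iff]; omega)
    · have : ¬ 4 ∣ #v := fun h4 => h ((hW v).2 ⟨h4, hv'⟩)
      exact Odd.neg_one_pow (by rw [Nat.odd_iff]; omega)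
  have hcount : (#W : ℤ) - #(D \ W) = 16 ^ r := by
    rw [Finset.sum_congr rfl hval, Finset.sum_ite, Finset.sum_const, Finset.sum_const] at gauss
    have e1 : {x ∈ D | x ∈ W} = W := by
      rw [filter_mem_eq_inter, inter_eq_right.2 hWD]
    have e2 : {x ∈ D | x ∉ W} = D \ W := by ext; simp
    rw [e1, e2] at gauss
    simp only [nsmul_eq_mul, mul_one, mul_neg] at gauss
    rw [← sub_eq_add_neg] at gauss
    exact_mod_cast gauss
  intro v
  refine ⟨fun hv => ((hW v).1 hv).2, fun hv => ?_⟩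
  by_contra hvW
  -- A vector v of the dual D outside W would translate W injectively into D \ W, against the
  -- positive difference in `hcount`.
  have hle : #W ≤ #(D \ W) := by
    refine card_le_card_of_injOn (· ∆ v) ?_ ?_
    · intro c hc
      rw [mem_coe] at hc
      simp only [coe_sdiff, Set.mem_sdiff, mem_coe]
      refine ⟨?_, fun h => hvW ?_⟩
      · rw [hD, mem_filter]
        refine ⟨mem_univ _, fun d hd => ?_⟩
        rw [even_card_symmDiff_inter]
        exact iff_of_true (((hW c).1 hc).2 d hd) (hv d hd)
      · have := hsymm c hc _ h
        rwa [symmDiff_symmDiff_cancel_left] at this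
    · exact fun a _ b _ h => symmDiff_left_injective v h
  have : (0 : ℤ) < 16 ^ r := by positivity
  omega

/-- Every doubly even self-orthogonal family on `8r` points extends to a doubly even self-dual
family. -/
theorem exists_selfDualFamily {r : ℕ} (hr : Fintype.card α = 8 * r)
    {B : Finset (Finset α)} (h4 : ∀ b ∈ B, 4 ∣ #b) (hB : ∀ a ∈ B, ∀ b ∈ B, Even #(a ∩ b)) :
    ∃ W, B ⊆ W ∧ SelfDualFamily W ∧ ∀ c ∈ W, 4 ∣ #c := by
  let p : Finset (Finset α) → Prop := fun W => (∀ b ∈ W, 4 ∣ #b) ∧ ∀ a ∈ W, ∀ b ∈ W, Even #(a ∩ b)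
  obtain ⟨W, hBW, hmax⟩ := (Set.toFinite {W | p W}).exists_le_maximal (a := B) ⟨h4, hB⟩
  have hp : p W := hmax.prop
  refine ⟨W, hBW, selfDualFamily_of_maximal hr fun v =>
    ⟨fun hv => ⟨hp.1 v hv, hp.2 v hv⟩, ?_⟩, hp.1⟩
  rintro ⟨hv4, hv⟩
  have hp' : p (insert v W) := by
    constructor
    · intro b hb
      rcases mem_insert.1 hb with rfl | hb
      exacts [hv4, hp.1 b hb]
    · intro a ha b hb
      rcases mem_insert.1 ha with rfl | ha' <;> rcases mem_insert.1 hb with rfl | hb'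
      · rw [inter_self, even_iff_two_dvd]
        exact (by norm_num : 2 ∣ 4).trans hv4
      · exact hv b hb'
      · rw [inter_comm]; exact hv a ha'
      · exact hp.2 a ha' b hb'
  exact hmax.le_of_ge hp' (subset_insert v W) (mem_insert_self v W)

end MaximalDoublyEven

/-! ### Counting in designs -/

section Designs

theorem sum_choose_card_inter {X : Type*} [DecidableEq X] (B : Finset (Finset X))
    (x : Finset X) (i : ℕ) :
    ∑ b ∈ B, (#(b ∩ x)).choose i = ∑ I ∈ powersetCard i x, #{b ∈ B | I ⊆ b} := by
  simp_rw [← card_powersetCard i, Finset.card_eq_sum_ones]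
  refine Finset.sum_comm' fun b I => ?_
  simp only [mem_filter, mem_powersetCard, subset_inter_iff]
  tauto

variable {X : Type*} [Fintype X] [DecidableEq X] {t v k lam : ℕ} {B : Finset (Finset X)}

/-- The number of blocks through a set of at most `t` points of a `t`-design. -/
theorem IsDesign.card_blocks_through_mul (hB : IsDesign t v k lam B) {I : Finset X} (hI : #I ≤ t) :
    #{b ∈ B | I ⊆ b} * (k - #I).choose (t - #I) = lam * (v - #I).choose (t - #I) := by
  have h1 : ∑ b ∈ B with I ⊆ b, #{T : Finset X | I ⊆ T ∧ T ⊆ b ∧ #T = #I + (t - #I)} =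
      ∑ T : Finset X with I ⊆ T ∧ T ⊆ univ ∧ #T = #I + (t - #I), #{b ∈ B | T ⊆ b} := by
    simp_rw [Finset.card_eq_sum_ones]
    refine Finset.sum_comm' fun b T => ?_
    simp only [mem_filter, mem_univ, true_and, subset_univ]
    constructor
    · rintro ⟨⟨h1, h2⟩, h3, h4, h5⟩
      exact ⟨⟨h1, h4⟩, h3, h5⟩
    · rintro ⟨⟨h1, h2⟩, h3, h4⟩
      exact ⟨⟨h1, h3.trans h2⟩, h3, h2, h4⟩
  rw [Finset.sum_congr rfl fun b hb => by
      rw [card_between (mem_filter.1 hb).2, hB.card_block b (mem_filter.1 hb).1],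
    Finset.sum_congr rfl fun T hT => hB.balanced T
      ((mem_filter.1 hT).2.2.2.trans (Nat.add_sub_cancel' hI)),
    Finset.sum_const, Finset.sum_const, card_between (subset_univ I), card_univ,
    hB.card_points] at h1
  rw [smul_eq_mul, smul_eq_mul] at h1
  rw [h1, mul_comm]

theorem IsDesign.card_blocks_through (hB : IsDesign t v k lam B) (htk : t ≤ k) {I : Finset X}
    (hI : #I ≤ t) :
    #{b ∈ B | I ⊆ b} = lam * (v - #I).choose (t - #I) / (k - #I).choose (t - #I) :=
  Nat.eq_div_of_mul_eq_left (Nat.choose_pos (by omega)).ne' (hB.card_blocks_through_mul hI)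

theorem IsDesign.card_eq (hB : IsDesign t v k lam B) (htk : t ≤ k) :
    #B = lam * v.choose t / k.choose t := by
  simpa using hB.card_blocks_through htk (I := ∅) (by simp)

/-- A set which meets every block of a `t`-design evenly: the binomial moments of the
intersection numbers rule out certain sizes. -/
theorem IsDesign.not_forall_even (hB : IsDesign t v k lam B) (htk : t ≤ k) {x : Finset X}
    (p : ℕ → ℤ) (hp : ∀ s ≤ #x, Even s → ∑ i ∈ range (t + 1), p i * s.choose i = 0)
    (hne : ∑ i ∈ range (t + 1), p i * ((#x).choose i *
      (lam * (v - i).choose (t - i) / (k - i).choose (t - i)) : ℕ) ≠ 0) :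
    ¬ ∀ b ∈ B, Even #(b ∩ x) := by
  intro h
  refine hne ?_
  calc ∑ i ∈ range (t + 1), p i * ((#x).choose i *
        (lam * (v - i).choose (t - i) / (k - i).choose (t - i)) : ℕ)
      = ∑ i ∈ range (t + 1), p i * (∑ b ∈ B, (#(b ∩ x)).choose i : ℕ) := by
        refine Finset.sum_congr rfl fun i hi => ?_
        rw [sum_choose_card_inter, Finset.sum_congr rfl fun I hI => by
          rw [hB.card_blocks_through htk
            (by rw [(mem_powersetCard.1 hI).2]; rw [mem_range] at hi; omega),
            (mem_powersetCard.1 hI).2], Finset.sum_const, card_powersetCard, smul_eq_mul]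
    _ = ∑ b ∈ B, ∑ i ∈ range (t + 1), p i * ((#(b ∩ x)).choose i : ℕ) := by
        rw [Finset.sum_comm]
        refine Finset.sum_congr rfl fun i _ => ?_
        rw [Nat.cast_sum, Finset.mul_sum]
    _ = 0 := Finset.sum_eq_zero fun b hb =>
        hp _ (card_le_card inter_subset_right) (h b hb)

end Designs

/-! ### Moment arguments for sizes and for 5-sets -/

section SelfDualFamily

namespace SelfDualFamily

variable {α : Type*} [Fintype α] [DecidableEq α] {W : Finset (Finset α)}

/-- The difference of the two sides of the MacWilliams identity for the polynomial with
coefficients `p` in the binomial basis, at a codeword of weight `w`. -/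
def momentGap (r N : ℕ) (p : ℕ → ℤ) (w : ℕ) : ℤ :=
  ∑ i ∈ range N, p i * (w.choose i - 2 ^ (r - i) * (2 * r - w).choose (2 * r - i))

theorem sum_momentGap (hW : SelfDualFamily W) {r N : ℕ} (hr : Fintype.card α = 2 * r)
    (hN : N ≤ r + 1) (p : ℕ → ℤ) : ∑ c ∈ W, momentGap r N p #c = 0 := by
  unfold momentGap
  rw [Finset.sum_comm]
  refine Finset.sum_eq_zero fun i hi => ?_
  rw [← Finset.mul_sum, Finset.sum_sub_distrib, ← Finset.mul_sum]
  rw [mem_range] at hi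
  have h := hW.sum_choose_card (i := i) (by omega)
  rw [hW.card_eq hr, hr, show r = (r - i) + i by omega, pow_add, mul_right_comm,
    show r - i + i = r by omega] at h
  have h2 := Nat.eq_of_mul_eq_mul_right (by positivity) h
  have h3 : ((∑ c ∈ W, (#c).choose i : ℕ) : ℤ) = _ := congrArg Nat.cast h2
  push_cast at h3
  rw [h3, sub_self, mul_zero]

/-- A doubly even self-dual family containing `B`, a family of sets of size `k`, without members
of size 4 or 8, has minimum size more than `4m`, provided `B` is large enough. -/
theorem four_mul_lt_card (hW : SelfDualFamily W) {m k : ℕ} (hm : Fintype.card α = 24 * m)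
    (h4 : ∀ c ∈ W, 4 ∣ #c) (hc4 : ∀ c ∈ W, #c ≠ 4) (hc8 : ∀ c ∈ W, #c ≠ 8)
    {B : Finset (Finset α)} (hB : B ⊆ W) (hBk : ∀ b ∈ B, #b = k) (hk : 4 * m < k)
    (hkm : k < 24 * m) (p : ℕ → ℤ)
    (hnonneg : ∀ j < 6 * m - 5, 0 ≤ momentGap (12 * m) (4 * m - 1) p (12 + 4 * j))
    (hpos : ∀ j < m - 2, 0 < momentGap (12 * m) (4 * m - 1) p (12 + 4 * j))
    (hsum : momentGap (12 * m) (4 * m - 1) p 0 + momentGap (12 * m) (4 * m - 1) p (24 * m) +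
      #B * momentGap (12 * m) (4 * m - 1) p k = 0) :
    ∀ c ∈ W, c.Nonempty → 4 * m < #c := by
  intro c₀ hc₀ hne
  by_contra! hlt
  -- Complementation also excludes 24m - 4 and 24m - 8, leaving sizes from 12 to 24m - 12.
  have hrange : ∀ c ∈ W, c.Nonempty → c ≠ univ → ∃ j < 6 * m - 5, #c = 12 + 4 * j := by
    intro c hc hcne hcu
    have h1 := hc4 c hc
    have h2 := hc8 c hc
    have h3 := hc4 _ (hW.compl_mem hc)
    have h4' := hc8 _ (hW.compl_mem hc)
    have h5 := h4 c hc
    have h6 := card_pos.2 hcne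
    have h7 := card_lt_card (ssubset_univ_iff.2 hcu)
    rw [card_univ] at h7
    rw [card_compl] at h3 h4'
    exact ⟨#c / 4 - 3, by omega, by omega⟩
  have huniv : #(univ : Finset α) = 24 * m := by rw [card_univ, hm]
  have hu₀ : c₀ ≠ univ := by
    rintro rfl
    omega
  have hc₀B : c₀ ∉ B := fun h => by have := hBk _ h; omega
  have huB : univ ∉ insert c₀ B := by
    rw [mem_insert, not_or]
    exact ⟨hu₀.symm, fun h => by have := hBk _ h; omega⟩
  have heB : ∅ ∉ insert univ (insert c₀ B) := by
    rw [mem_insert, mem_insert, not_or, not_or]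
    refine ⟨fun h => ?_, hne.ne_empty.symm, fun h => ?_⟩
    · rw [← h, card_empty] at huniv; omega
    · have := hBk _ h
      rw [card_empty] at this; omega
  have hsub : insert ∅ (insert univ (insert c₀ B)) ⊆ W := by
    simp only [insert_subset_iff]
    exact ⟨hW.empty_mem, hW.univ_mem, hc₀, hB⟩
  -- The total over W is 0; dropping nonnegative terms leaves `hsum`, which is 0, plus the positive
  -- term of c₀.
  have hle := Finset.sum_le_sum_of_subset_of_nonneg
    (f := fun c : Finset α => momentGap (12 * m) (4 * m - 1) p #c) hsub (by
      intro c hc hcn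
      simp only [mem_insert, not_or] at hcn
      obtain ⟨j, hj, hcj⟩ := hrange c hc (nonempty_iff_ne_empty.2 hcn.1) hcn.2.1
      simpa only [hcj] using hnonneg j hj)
  rw [hW.sum_momentGap (by omega) (by omega), sum_insert heB, sum_insert huB, sum_insert hc₀B,
    Finset.sum_congr rfl fun b hb => by rw [hBk b hb], Finset.sum_const, nsmul_eq_mul, huniv,
    card_empty] at hle
  obtain ⟨j, hj, hcj⟩ := hrange c₀ hc₀ hne hu₀
  have := hpos j (by omega)
  rw [hcj] at hle
  linarith

/-- The number of members of size `k` through a 5-set is determined. -/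
theorem card_mul_add (hW : SelfDualFamily W) {m k : ℕ} (hm : Fintype.card α = 24 * m)
    (h4 : ∀ c ∈ W, 4 ∣ #c) (hd : ∀ c ∈ W, c.Nonempty → 4 * m < #c) (hk : k < 24 * m)
    (q : ℕ → ℤ)
    (hq : ∀ j < 4 * m - 1, 4 * m + 4 + 4 * j ≠ k →
      ∑ i ∈ range (4 * m - 1), q i * (4 * m + 4 + 4 * j - 5).choose i = 0)
    {T : Finset α} (hT : #T = 5) :
    #{c ∈ W | #c = k ∧ T ⊆ c} * (∑ i ∈ range (4 * m - 1), q i * (k - 5).choose i) +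
      ∑ i ∈ range (4 * m - 1), q i * (24 * m - 5).choose i =
      ∑ i ∈ range (4 * m - 1), q i * (2 ^ (12 * m - 5 - i) * (24 * m - 5).choose i) := by
  have huniv : #(univ : Finset α) = 24 * m := by rw [card_univ, hm]
  have h1 : ∑ c ∈ W with T ⊆ c, ∑ i ∈ range (4 * m - 1), q i * (#c - 5).choose i =
      ∑ i ∈ range (4 * m - 1), q i * (2 ^ (12 * m - 5 - i) * (24 * m - 5).choose i) := by
    rw [Finset.sum_comm]
    refine Finset.sum_congr rfl fun i hi => ?_
    rw [mem_range] at hi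
    rw [← Finset.mul_sum]
    congr 1
    -- The condition 5 + i < 4m + 4 is exactly i < 4m - 1: this is why 5-sets go with degree 4m - 2.
    have h := hW.sum_choose_supersets_of_lt (d := 4 * m + 4)
      (fun c hc hne => by have := h4 c hc; have := hd c hc hne; omega) T (i := i) (by omega)
    rw [hW.card_eq (r := 12 * m) (by omega), hm, hT,
      show 2 ^ (12 * m) = 2 ^ (12 * m - 5 - i) * 2 ^ (5 + i) by rw [← pow_add]; congr 1; omega,
      mul_right_comm] at h
    exact_mod_cast Nat.eq_of_mul_eq_mul_right (by positivity) h
  rw [← h1, ← Finset.sum_filter_add_sum_filter_not {c ∈ W | T ⊆ c} (fun c => #c = k)]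
  congr 1
  · rw [filter_filter, Finset.card_eq_sum_ones, Nat.cast_sum, Finset.sum_mul]
    refine Finset.sum_congr (by simp only [and_comm]) fun c hc => ?_
    rw [(mem_filter.1 hc).2.2, Nat.cast_one, one_mul]
  -- Any other member has a nonempty complement of size more than 4m, so its size is one of 4m + 4,
  -- ..., 20m - 4, where the polynomial vanishes.
  · rw [Finset.sum_eq_single univ, huniv]
    · intro c hc hcu
      simp only [mem_filter] at hc
      obtain ⟨⟨hcW, hTc⟩, hck⟩ := hc
      have hne : c.Nonempty := card_pos.1 (by have := card_le_card hTc; omega)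
      have h5 := hd c hcW hne
      have h6 := h4 c hcW
      have h7 : (cᶜ : Finset α).Nonempty := nonempty_iff_ne_empty.2 fun h => hcu (by simpa using h)
      have h8 := hd _ (hW.compl_mem hcW) h7
      rw [card_compl] at h8
      obtain ⟨j, hj, hcj⟩ : ∃ j < 4 * m - 1, #c = 4 * m + 4 + 4 * j :=
        ⟨#c / 4 - m - 1, by omega, by omega⟩
      rw [hcj]
      exact hq j hj (hcj ▸ hck)
    · intro h
      refine absurd (mem_filter.2 ⟨mem_filter.2 ⟨hW.univ_mem, subset_univ _⟩, ?_⟩) h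
      omega

end SelfDualFamily

end SelfDualFamily

/-! ### Codes and families of supports -/

section Codes

variable {n : ℕ}

/-- The indicator vector of a set of coordinates. -/
def indicatorWord (s : Finset (Fin n)) : Fin n → ZMod 2 := fun i => if i ∈ s then 1 else 0

/-- The support of a binary vector. -/
def wordSupport (x : Fin n → ZMod 2) : Finset (Fin n) := {i | x i ≠ 0}

theorem hammingNorm_eq_card_wordSupport (x : Fin n → ZMod 2) : hammingNorm x = #(wordSupport x) :=
  rfl

@[simp]
theorem wordSupport_indicatorWord (s : Finset (Fin n)) : wordSupport (indicatorWord s) = s := by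
  ext i
  simp [wordSupport, indicatorWord]

@[simp]
theorem indicatorWord_wordSupport (x : Fin n → ZMod 2) : indicatorWord (wordSupport x) = x := by
  funext i
  have h : ∀ a : ZMod 2, (if a ≠ 0 then 1 else 0) = a := by decide
  simpa [wordSupport, indicatorWord] using h (x i)

theorem wordSupport_nonempty {x : Fin n → ZMod 2} : (wordSupport x).Nonempty ↔ x ≠ 0 := by
  rw [Function.ne_iff]
  simp [wordSupport, Finset.Nonempty]

theorem dotProduct_eq_zero_iff_even (x y : Fin n → ZMod 2) :
    x ⬝ᵥ y = 0 ↔ Even #(wordSupport x ∩ wordSupport y) := by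
  have h : ∀ a b : ZMod 2, a * b = if a ≠ 0 ∧ b ≠ 0 then 1 else 0 := by decide
  have h2 : x ⬝ᵥ y = (#(wordSupport x ∩ wordSupport y) : ℕ) := by
    rw [dotProduct, Finset.sum_congr rfl fun i _ => h (x i) (y i), ← Finset.sum_filter,
      Finset.sum_const, nsmul_one, filter_and]
    rfl
  rw [h2, ZMod.natCast_eq_zero_iff_even]

namespace BinaryCode

open Classical in
/-- The supports of the codewords. -/
noncomputable def supports (C : BinaryCode n) : Finset (Finset (Fin n)) :=
  {s | indicatorWord s ∈ C}

theorem mem_supports {C : BinaryCode n} {s : Finset (Fin n)} :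
    s ∈ C.supports ↔ indicatorWord s ∈ C := by
  simp [supports]

theorem wordSupport_mem_supports {C : BinaryCode n} {x : Fin n → ZMod 2} :
    wordSupport x ∈ C.supports ↔ x ∈ C := by
  simp [mem_supports]

theorem IsSelfDual.selfDualFamily {C : BinaryCode n} (hC : C.IsSelfDual) :
    SelfDualFamily C.supports := by
  intro y
  have key : indicatorWord y ∈ C ↔ ∀ c ∈ C, indicatorWord y ⬝ᵥ c = 0 := by
    conv_lhs => rw [hC]
    rfl
  rw [mem_supports, key]
  constructor
  · intro h c hc
    have := (dotProduct_eq_zero_iff_even _ _).1 (h _ (mem_supports.1 hc))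
    simpa using this
  · intro h x hx
    rw [dotProduct_eq_zero_iff_even, wordSupport_indicatorWord]
    exact h _ (wordSupport_mem_supports.2 hx)

/-- The code of all vectors orthogonal to a family of sets. -/
def orthogonal (W : Finset (Finset (Fin n))) : BinaryCode n where
  carrier := {x | ∀ s ∈ W, x ⬝ᵥ indicatorWord s = 0}
  zero_mem' := fun s _ => zero_dotProduct _
  add_mem' := fun hx hy s hs => by rw [add_dotProduct, hx s hs, hy s hs, add_zero]
  smul_mem' := fun a x hx s hs => by rw [smul_dotProduct, hx s hs, smul_zero]

theorem mem_orthogonal {W : Finset (Finset (Fin n))} (hW : SelfDualFamily W)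
    {x : Fin n → ZMod 2} : x ∈ orthogonal W ↔ wordSupport x ∈ W := by
  rw [hW]
  refine forall₂_congr fun s _ => ?_
  rw [dotProduct_eq_zero_iff_even, wordSupport_indicatorWord]

theorem isSelfDual_orthogonal {W : Finset (Finset (Fin n))} (hW : SelfDualFamily W) :
    (orthogonal W).IsSelfDual := by
  refine SetLike.ext fun x => ?_
  constructor
  · intro hx c hc
    rw [dotProduct_eq_zero_iff_even]
    exact (hW _).1 ((mem_orthogonal hW).1 hx) _ ((mem_orthogonal hW).1 hc)
  · exact fun hx s hs => hx _ ((mem_orthogonal hW).2 (by simpa using hs))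

end BinaryCode

end Codes

/-! ### Numerical certificates -/

section Certificates

/-- The coefficients of `f (t + x)` in the binomial basis (Newton's forward differences). -/
def newtonCoeff (f : ℤ → ℤ) (t i : ℕ) : ℤ :=
  ∑ j ∈ range (i + 1), (-1) ^ (i - j) * (i.choose j : ℤ) * f (t + j : ℕ)

/-- The polynomial whose zeros are the multiples of 4 from `4m + 4` to `20m - 4`, except `k`. -/
def weightPoly (m k : ℕ) (x : ℤ) : ℤ :=
  ∏ j ∈ range (4 * m - 1), if 4 * m + 4 + 4 * j = k then 1 else x - (4 * m + 4 + 4 * j : ℕ)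

/-- Numerical conditions under which, in the presence of a self-orthogonal `5`-`(24m, k, lam)`
design, all weights of a doubly even self-dual code other than `0` exceed `4m`. -/
def WeightCertificate (m k lam : ℕ) : Prop :=
  (∀ w ∈ [4, 8], ∑ i ∈ range (5 + 1),
    newtonCoeff (fun s => s * (s - 2) * (s - 4) * (s - 6) * (s - 8)) 0 i *
      (w.choose i * (lam * (24 * m - i).choose (5 - i) / (k - i).choose (5 - i)) : ℕ) ≠ 0) ∧
  (∀ j < 6 * m - 5, 0 ≤ SelfDualFamily.momentGap (12 * m) (4 * m - 1)
    (newtonCoeff (weightPoly m k) 0) (12 + 4 * j)) ∧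
  (∀ j < m - 2, 0 < SelfDualFamily.momentGap (12 * m) (4 * m - 1)
    (newtonCoeff (weightPoly m k) 0) (12 + 4 * j)) ∧
  SelfDualFamily.momentGap (12 * m) (4 * m - 1) (newtonCoeff (weightPoly m k) 0) 0 +
    SelfDualFamily.momentGap (12 * m) (4 * m - 1) (newtonCoeff (weightPoly m k) 0) (24 * m) +
    (lam * (24 * m).choose 5 / k.choose 5 : ℕ) *
      SelfDualFamily.momentGap (12 * m) (4 * m - 1) (newtonCoeff (weightPoly m k) 0) k = 0

/-- Numerical conditions under which the words of weight `k` of an extremal doubly even self-dual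
code of length `24m` cover every set of 5 coordinates exactly `lam` times. -/
def CoverCertificate (m k lam : ℕ) : Prop :=
  (∀ j < 4 * m - 1, 4 * m + 4 + 4 * j ≠ k →
    ∑ i ∈ range (4 * m - 1),
      newtonCoeff (weightPoly m k) 5 i * (4 * m + 4 + 4 * j - 5).choose i = 0) ∧
  ∑ i ∈ range (4 * m - 1), newtonCoeff (weightPoly m k) 5 i * (k - 5).choose i ≠ 0 ∧
  lam * (∑ i ∈ range (4 * m - 1), newtonCoeff (weightPoly m k) 5 i * (k - 5).choose i) +
    ∑ i ∈ range (4 * m - 1), newtonCoeff (weightPoly m k) 5 i * (24 * m - 5).choose i =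
    ∑ i ∈ range (4 * m - 1),
      newtonCoeff (weightPoly m k) 5 i * (2 ^ (12 * m - 5 - i) * (24 * m - 5).choose i)

/-- Falling factorials keep the evaluation of the certificates feasible, unlike Pascal's recursion.
-/
theorem choose_eq_descFactorial_div :
    Nat.choose = fun n k => n.descFactorial k / k.factorial := by
  funext n k
  exact Nat.choose_eq_descFactorial_div_factorial n k

theorem sum_newtonCoeff_eq_zero : ∀ s ≤ 8, Even s → ∑ i ∈ range (5 + 1),
    newtonCoeff (fun s => s * (s - 2) * (s - 4) * (s - 6) * (s - 8)) 0 i * s.choose i = 0 := by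
  simp only [newtonCoeff, choose_eq_descFactorial_div]
  decide +kernel

/-- The values of `(m, k, lam)` for the designs. -/
def designParameters : List (ℕ × ℕ × ℕ) :=
  [(3, 24, 1406405), (3, 32, 238957796), (4, 36, 28080500448), (4, 44, 1167789832440),
    (5, 56, 5156299310025435), (6, 68, 21788133027489299328)]

/-- For w > 4m - 2 the second binomial in `momentGap` is zero, so the gap is the value of
`weightPoly`, which vanishes at 4m + 4, ..., 20m - 4 except k. Only smaller w feel the dual term. -/
theorem weightCertificate_of_mem :
    ∀ x ∈ designParameters, WeightCertificate x.1 x.2.1 x.2.2 := by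
  simp only [WeightCertificate, SelfDualFamily.momentGap, newtonCoeff, choose_eq_descFactorial_div]
  decide +kernel

theorem coverCertificate_of_mem :
    ∀ x ∈ designParameters, CoverCertificate x.1 x.2.1 x.2.2 := by
  simp only [CoverCertificate, newtonCoeff, choose_eq_descFactorial_div]
  decide +kernel

/-- The second entries count the words of weight 4m + 4 through five coordinates; only their being
nonzero matters later. -/
theorem coverCertificate_min : ∀ x ∈ [(3, 78), (4, 816), (5, 8855), (6, 98280)],
    CoverCertificate x.1 (4 * x.1 + 4) x.2 := by
  simp only [CoverCertificate, newtonCoeff, choose_eq_descFactorial_div]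
  decide +kernel

end Certificates

/-! ### The equivalence of designs and codes -/

theorem SelfDualFamily.exists_card_eq_four_mul_add_four {α : Type*} [Fintype α] [DecidableEq α]
    {W : Finset (Finset α)} (hW : SelfDualFamily W) {m l : ℕ} (hm : Fintype.card α = 24 * m)
    (hm1 : 1 ≤ m) (h4 : ∀ c ∈ W, 4 ∣ #c) (hd : ∀ c ∈ W, c.Nonempty → 4 * m < #c)
    (hl : l ≠ 0) (hc : CoverCertificate m (4 * m + 4) l) : ∃ c ∈ W, #c = 4 * m + 4 := by
  obtain ⟨T, -, hT⟩ := exists_subset_card_eq (s := (univ : Finset α)) (n := 5)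
    (by rw [card_univ]; omega)
  have h := hW.card_mul_add hm h4 hd (by omega) _ hc.1 hT
  rw [← hc.2.2, add_left_inj] at h
  have h' := mul_right_cancel₀ hc.2.1 h
  have hpos : 0 < #{c ∈ W | #c = 4 * m + 4 ∧ T ⊆ c} := by
    have : #{c ∈ W | #c = 4 * m + 4 ∧ T ⊆ c} = l := by exact_mod_cast h'
    omega
  obtain ⟨c, hc⟩ := card_pos.1 hpos
  exact ⟨c, (mem_filter.1 hc).1, (mem_filter.1 hc).2.1⟩

/-- A doubly even self-dual family containing the blocks of a suitable design has minimum size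
more than `4m`. -/
theorem SelfDualFamily.four_mul_lt_card_of_design {α : Type*} [Fintype α] [DecidableEq α]
    {W B : Finset (Finset α)} (hW : SelfDualFamily W) (h4 : ∀ c ∈ W, 4 ∣ #c) (hBW : B ⊆ W)
    {m k lam : ℕ} (hB : IsDesign 5 (24 * m) k lam B) (h5k : 5 ≤ k) (hk : 4 * m < k)
    (hkm : k < 24 * m) (hc : WeightCertificate m k lam) :
    ∀ c ∈ W, c.Nonempty → 4 * m < #c := by
  obtain ⟨h1, h2, h3, h5⟩ := hc
  have hne (w : ℕ) (hw : w ∈ [4, 8]) : ∀ c ∈ W, #c ≠ w := by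
    rintro c hc rfl
    refine hB.not_forall_even h5k _
      (fun s hs hs2 => sum_newtonCoeff_eq_zero s ?_ hs2)
      (h1 _ hw) fun b hb => (hW b).1 (hBW hb) c hc
    simp at hw
    omega
  refine hW.four_mul_lt_card hB.card_points h4 (hne 4 (by simp)) (hne 8 (by simp)) hBW
    hB.card_block hk hkm _ h2 h3 ?_
  rw [hB.card_eq h5k]
  exact h5

theorem exists_design_iff_exists_code {m k lam : ℕ} (hx : (m, k, lam) ∈ designParameters) :
    (∃ B : Finset (Finset (Fin (24 * m))), IsSelfOrthogonalDesign 5 (24 * m) k lam B) ↔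
      ∃ C : BinaryCode (24 * m), BinaryCode.IsExtremalDoublyEvenSelfDual C := by
  have hcard : Fintype.card (Fin (24 * m)) = 24 * m := Fintype.card_fin _
  have hbounds : ∀ x ∈ designParameters,
      1 ≤ x.1 ∧ 4 ∣ x.2.1 ∧ 4 * x.1 < x.2.1 ∧ x.2.1 < 24 * x.1 := by decide
  obtain ⟨hm, hk4, hk, hkm⟩ : 1 ≤ m ∧ 4 ∣ k ∧ 4 * m < k ∧ k < 24 * m := hbounds _ hx
  constructor
  · rintro ⟨B, hB⟩
    have hB4 : ∀ b ∈ B, 4 ∣ #b := fun b hb => by rw [hB.card_block b hb]; exact hk4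
    have hB2 : ∀ a ∈ B, ∀ b ∈ B, Even #(a ∩ b) := by
      intro a ha b hb
      rw [Nat.even_iff]
      by_cases hab : a = b
      · have := hB4 a ha
        rw [hab, inter_self, ← hab]
        omega
      · have : #(a ∩ b) % 2 = k % 2 := hB.inter_parity a ha b hb hab
        omega
    obtain ⟨W, hBW, hW, hW4⟩ := exists_selfDualFamily (r := 3 * m) (by omega) hB4 hB2
    have hd := hW.four_mul_lt_card_of_design hW4 hBW hB.toIsDesign (by omega) hk hkm
      (weightCertificate_of_mem _ hx)
    refine ⟨BinaryCode.orthogonal W, fun c hc => hW4 _ ((BinaryCode.mem_orthogonal hW).1 hc),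
      BinaryCode.isSelfDual_orthogonal hW, ?_, ?_⟩
    · have hl : ∃ l ≠ 0, CoverCertificate m (4 * m + 4) l := by
        have : ∀ x ∈ designParameters,
            ∃ y ∈ [(3, 78), (4, 816), (5, 8855), (6, 98280)], y.1 = x.1 ∧ y.2 ≠ 0 := by decide
        obtain ⟨y, hy, rfl, hy0⟩ := this _ hx
        exact ⟨y.2, hy0, coverCertificate_min y hy⟩
      obtain ⟨l, hl0, hl⟩ := hl
      obtain ⟨c, hcW, hc⟩ := hW.exists_card_eq_four_mul_add_four hcard hm hW4 hd hl0 hl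
      refine ⟨indicatorWord c, (BinaryCode.mem_orthogonal hW).2 (by simpa using hcW), ?_, ?_⟩
      · rw [← wordSupport_nonempty, wordSupport_indicatorWord, ← card_pos]
        omega
      · rw [hammingNorm_eq_card_wordSupport, wordSupport_indicatorWord, hc]
        omega
    · rintro w ⟨c, hc, hc0, rfl⟩
      have hcW := (BinaryCode.mem_orthogonal hW).1 hc
      have h1 := hd _ hcW (wordSupport_nonempty.2 hc0)
      have h2 := hW4 _ hcW
      rw [hammingNorm_eq_card_wordSupport]
      omega
  · rintro ⟨C, hC⟩
    have hW := hC.selfDual.selfDualFamily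
    have hW4 : ∀ c ∈ C.supports, 4 ∣ #c := by
      intro c hc
      have := hC.doublyEven _ (BinaryCode.mem_supports.1 hc)
      rwa [hammingNorm_eq_card_wordSupport, wordSupport_indicatorWord] at this
    have hd : ∀ c ∈ C.supports, c.Nonempty → 4 * m < #c := by
      intro c hc hne
      have := hC.minWeight.2 ⟨_, BinaryCode.mem_supports.1 hc,
        by rwa [← wordSupport_nonempty, wordSupport_indicatorWord], rfl⟩
      rw [hammingNorm_eq_card_wordSupport, wordSupport_indicatorWord] at this
      omega
    refine ⟨{c ∈ C.supports | #c = k}, ⟨hcard, fun b hb => (mem_filter.1 hb).2, ?_⟩, ?_⟩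
    · intro T hT
      have hc := coverCertificate_of_mem _ hx
      have h := hW.card_mul_add hcard hW4 hd hkm _ hc.1 hT
      rw [← hc.2.2, add_left_inj] at h
      rw [filter_filter]
      exact_mod_cast mul_right_cancel₀ hc.2.1 h
    · intro a ha b hb _
      have := (hW a).1 (mem_filter.1 ha).1 b (mem_filter.1 hb).1
      rw [Nat.even_iff] at this
      rw [Nat.ModEq]
      omega

theorem theorem1 (m k lam : ℕ)
    (h : (24 * m, k, lam) ∈ ({(72, 24, 1406405), (72, 32, 238957796),
      (96, 36, 28080500448), (96, 44, 1167789832440),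
      (120, 56, 5156299310025435), (144, 68, 21788133027489299328)} : Set (ℕ × ℕ × ℕ))) :
    (∃ B : Finset (Finset (Fin (24 * m))), IsSelfOrthogonalDesign 5 (24 * m) k lam B) ↔
      ∃ C : BinaryCode (24 * m), BinaryCode.IsExtremalDoublyEvenSelfDual C := by
  apply exists_design_iff_exists_code
  simp only [Set.mem_insert_iff, Set.mem_singleton_iff, Prod.mk.injEq] at h
  rcases h with ⟨hm, rfl, rfl⟩ | ⟨hm, rfl, rfl⟩ | ⟨hm, rfl, rfl⟩ | ⟨hm, rfl, rfl⟩ |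
    ⟨hm, rfl, rfl⟩ | ⟨hm, rfl, rfl⟩
  · obtain rfl : m = 3 := by omega
    simp [designParameters]
  · obtain rfl : m = 3 := by omega
    simp [designParameters]
  · obtain rfl : m = 4 := by omega
    simp [designParameters]
  · obtain rfl : m = 4 := by omega
    simp [designParameters]
  · obtain rfl : m = 5 := by omega
    simp [designParameters]
  · obtain rfl : m = 6 := by omega
    simp [designParameters]
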